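/- Let $d$ be a natural number and, for each $n\in\mathbb{Z}$, let $C(n)=(c_{ij}(n))$ be an invertible upper triangular real $d\times d$ matrix, such that $$\sup_{n\in\mathbb{Z}}\|C(n)\|<\infty\quad\text{and}\quad\sup_{n\in\mathbb{Z}}\|C(n)^{-1}\|<\infty .$$ For a sequence $A(n)$, $n\in\mathbb{Z}$, of invertible real $m\times m$ matrices, let $X$ be the fundamental matrix of $x(n+1)=A(n)x(n)$ with $X(0)=I$. The system has an exponential dichotomy on $\mathbb{Z}$ if there are $K\ge 1$, $\rho\in(0,1)$ and a matrix $P$ with $P^2=P$ such that $\|X(n)PX(k)^{-1}\|\le K\rho^{n-k}$ for all integers $n\ge k$ and $\|X(n)(I-P)X(k)^{-1}\|\le K\rho^{k-n}$ for all integers $n\le k$. The Sacker--Sell spectrum $\Sigma(A)$ is the set of all $\lambda>0$ for which the system $x(n+1)=\lambda^{-1}A(n)x(n)$ does not have an exponential dichotomy on $\mathbb{Z}$. If $\Sigma(C)=[a,b]$ for some real numbers $a\le b$, then $$\Sigma(C)=\bigcup_{i=1}^{d}\Sigma(c_{ii}),$$ where $\Sigma(c_{ii})$ is the spectrum of the scalar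 equation $u(n+1)=c_{ii}(n)u(n)$. (Here $\|\cdot\|$ is the norm $\|A\|_\infty=\max_i\sum_j|a_{ij}|$; neither the hypotheses nor the spectra depend on the choice of the matrix norm.) -/

import Mathlib

-- Matrices carry the norm `‖A‖_∞ = max_i ∑_j |a_ij|`.
attribute [local instance] Matrix.linftyOpNormedRing

namespace DifferenceSystem

variable {d : ℕ}

/-- `A (n - 1) * ⋯ * A 0` for `n : ℕ` (the identity for `n = 0`). -/
noncomputable def forwardProd (A : ℤ → Matrix (Fin d) (Fin d) ℝ) : ℕ → Matrix (Fin d) (Fin d) ℝ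
  | 0 => 1
  | n + 1 => A (n : ℤ) * forwardProd A n

/-- `(A (-n))⁻¹ * ⋯ * (A (-1))⁻¹` for `n : ℕ` (the identity for `n = 0`). -/
noncomputable def backwardProd (A : ℤ → Matrix (Fin d) (Fin d) ℝ) : ℕ → Matrix (Fin d) (Fin d) ℝ
  | 0 => 1
  | n + 1 => (A (-((n : ℤ) + 1)))⁻¹ * backwardProd A n

/-- The fundamental matrix `X n`, normalized by `X 0 = 1`, of `x (n + 1) = A n x n`, `n : ℤ`,
where every `A n` is invertible. -/
noncomputable def fundamentalMatrix (A : ℤ → Matrix (Fin d) (Fin d) ℝ) (n : ℤ) :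
    Matrix (Fin d) (Fin d) ℝ :=
  if 0 ≤ n then forwardProd A n.toNat else backwardProd A (-n).toNat

/-- The system `x (n + 1) = A n x n` has an exponential dichotomy on `ℤ`. -/
def HasExpDichotomy (A : ℤ → Matrix (Fin d) (Fin d) ℝ) : Prop :=
  ∃ (K ρ : ℝ) (P : Matrix (Fin d) (Fin d) ℝ),
    1 ≤ K ∧ 0 < ρ ∧ ρ < 1 ∧ P ^ 2 = P ∧
    (∀ n k : ℤ, k ≤ n →
      ‖fundamentalMatrix A n * P * (fundamentalMatrix A k)⁻¹‖ ≤ K * ρ ^ (n - k)) ∧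
    (∀ n k : ℤ, n ≤ k →
      ‖fundamentalMatrix A n * (1 - P) * (fundamentalMatrix A k)⁻¹‖ ≤ K * ρ ^ (k - n))

/-- The Sacker--Sell (exponential dichotomy) spectrum of `x (n + 1) = A n x n`. -/
def sackerSellSpectrum (A : ℤ → Matrix (Fin d) (Fin d) ℝ) : Set ℝ :=
  {μ : ℝ | 0 < μ ∧ ¬ HasExpDichotomy (fun n => μ⁻¹ • A n)}

/-- A scalar equation `x (n + 1) = c n x n`, as a system of dimension one. -/
def scalarSystem (c : ℤ → ℝ) : ℤ → Matrix (Fin 1) (Fin 1) ℝ :=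
  fun n => Matrix.of fun _ _ => c n

end DifferenceSystem

/-! An exponential dichotomy amounts to invertibility of the operator `x ↦ x (n + 1) - A n * x n`
with an exponentially decaying inverse kernel (`hasExpDichotomy_iff_exists_isGreenKernel`). This
formulation interacts well with triangular structure.

If every diagonal equation has a Green kernel, these form one for the diagonal part of `C`. The rest
`N` is strictly upper triangular and bounded, so the Neumann series `∑ G₀ (N G₀) ^ m` stops before
`m = d` and gives a kernel for `C` (`hasExpDichotomy_of_diag`). Hence `Σ(C)` lies in the union.

Conversely, the diagonal entries of a Green kernel of `C` solve the scalar equations provided the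
kernel is upper triangular, i.e. provided the projection is (`hasExpDichotomy_diag`). This is where
the interval matters: the resolvent set is `(0, a) ∪ (b, ∞)`, the projection is constant on each
piece (`expDecay_of_isPreconnected`), and boundedness of `C⁻¹` and `C` makes it `0` near `0` and `1`
near `∞`. Both are triangular. -/

/-! ### Exponentially decaying kernels -/

section Kernel

variable {R : Type*} [NormedRing R]

/-- Off-diagonal exponential decay of a kernel on `ℤ × ℤ`. -/
def ExpDecay (g : ℤ → ℤ → R) : Prop :=
  ∃ K ρ : ℝ, 0 < ρ ∧ ρ < 1 ∧ ∀ n k, ‖g n k‖ ≤ K * ρ ^ (n - k).natAbs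

/-- A two-sided inverse, with exponentially decaying kernel, of the operator
`x ↦ (x (n + 1) - A n * x n)`. -/
structure IsGreenKernel (A : ℤ → R) (G : ℤ → ℤ → R) : Prop where
  left : ∀ n k, G (n + 1) k = A n * G n k + if n + 1 = k then 1 else 0
  right : ∀ n k, G n k = G n (k + 1) * A k + if n = k then 1 else 0
  decay : ExpDecay G

/-- Composition of kernels. -/
noncomputable def kernelComp (f g : ℤ → ℤ → R) (n k : ℤ) : R := ∑' j, f n j * g j k

theorem ExpDecay.exists_common_rate {f g : ℤ → ℤ → R} (hf : ExpDecay f) (hg : ExpDecay g) :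
    ∃ K L ρ : ℝ, 0 ≤ K ∧ 0 ≤ L ∧ 0 < ρ ∧ ρ < 1 ∧ (∀ n k, ‖f n k‖ ≤ K * ρ ^ (n - k).natAbs) ∧
      ∀ n k, ‖g n k‖ ≤ L * ρ ^ (n - k).natAbs := by
  obtain ⟨K, ρ, h0, h1, h⟩ := hf
  obtain ⟨L, σ, k0, k1, k⟩ := hg
  have hK : 0 ≤ K := by simpa using (norm_nonneg _).trans (h 0 0)
  have hL : 0 ≤ L := by simpa using (norm_nonneg _).trans (k 0 0)
  refine ⟨K, L, max ρ σ, hK, hL, lt_max_of_lt_left h0, max_lt h1 k1, fun n m => ?_, fun n m => ?_⟩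
  · refine (h n m).trans ?_
    gcongr
    exact le_max_left _ _
  · refine (k n m).trans ?_
    gcongr
    exact le_max_right _ _

theorem expDecay_zero : ExpDecay (fun _ _ => (0 : R)) :=
  ⟨0, 1 / 2, by norm_num, by norm_num, by simp⟩

theorem ExpDecay.add {f g : ℤ → ℤ → R} (hf : ExpDecay f) (hg : ExpDecay g) :
    ExpDecay (fun n k => f n k + g n k) := by
  obtain ⟨K, L, ρ, -, -, h0, h1, h, k⟩ := hf.exists_common_rate hg
  refine ⟨K + L, ρ, h0, h1, fun n m => ?_⟩
  rw [add_mul]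
  exact (norm_add_le _ _).trans (add_le_add (h n m) (k n m))

theorem ExpDecay.sum {ι : Type*} (s : Finset ι) {f : ι → ℤ → ℤ → R}
    (hf : ∀ i, ExpDecay (f i)) : ExpDecay (fun n k => ∑ i ∈ s, f i n k) := by
  classical
  induction s using Finset.induction_on with
  | empty => simpa using expDecay_zero
  | insert i s hi ih => simpa [Finset.sum_insert hi] using (hf i).add ih

theorem ExpDecay.of_norm_le {S : Type*} [NormedRing S] {f : ℤ → ℤ → R} {g : ℤ → ℤ → S}
    (hf : ExpDecay f) (h : ∀ n k, ‖g n k‖ ≤ ‖f n k‖) : ExpDecay g := by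
  obtain ⟨K, ρ, h0, h1, hK⟩ := hf
  exact ⟨K, ρ, h0, h1, fun n k => (h n k).trans (hK n k)⟩

/-- In `x (n + 1) = A n * x n + f n` the source at time `k` acts at time `k + 1`; this is the kernel
of multiplying by `N` and then solving. -/
theorem ExpDecay.shift_mul {g : ℤ → ℤ → R} (hg : ExpDecay g) {N : ℤ → R} {M : ℝ}
    (hN : ∀ n, ‖N n‖ ≤ M) : ExpDecay (fun n k => g n (k + 1) * N k) := by
  obtain ⟨K, ρ, h0, h1, h⟩ := hg
  have hK : 0 ≤ K := by simpa using (norm_nonneg _).trans (h 0 0)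
  have hM : 0 ≤ M := (norm_nonneg _).trans (hN 0)
  -- The factor `ρ⁻¹` pays for the shift by one.
  refine ⟨K * ρ⁻¹ * M, ρ, h0, h1, fun n k => ?_⟩
  have h2 : ρ ^ (n - (k + 1)).natAbs ≤ ρ⁻¹ * ρ ^ (n - k).natAbs := by
    rw [inv_mul_eq_div, le_div_iff₀ h0, ← pow_succ]
    exact pow_le_pow_of_le_one h0.le h1.le (by omega)
  calc ‖g n (k + 1) * N k‖ ≤ ‖g n (k + 1)‖ * ‖N k‖ := norm_mul_le _ _
    _ ≤ (K * (ρ⁻¹ * ρ ^ (n - k).natAbs)) * M := by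
        gcongr
        · exact (h _ _).trans (by gcongr)
        · exact hN k
    _ = _ := by ring

theorem summable_pow_natAbs {σ : ℝ} (h0 : 0 < σ) (h1 : σ < 1) :
    Summable (fun j : ℤ => σ ^ j.natAbs) := by
  refine Summable.of_nat_of_neg ?_ ?_ <;>
    simpa using summable_geometric_of_lt_one h0.le h1

/-- Passing to the rate `√ρ` doubles the exponents, and `2|n - j| + 2|j - k| ≥ |n - k| + |j - k|`:
one part gives decay of the composition, the other summability in `j`. -/
theorem ExpDecay.exists_norm_mul_le {f g : ℤ → ℤ → R} (hf : ExpDecay f) (hg : ExpDecay g) :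
    ∃ K σ : ℝ, 0 ≤ K ∧ 0 < σ ∧ σ < 1 ∧
      ∀ n k j, ‖f n j * g j k‖ ≤ K * σ ^ (n - k).natAbs * σ ^ (j - k).natAbs := by
  obtain ⟨K, L, ρ, hK, hL, h0, h1, h, k⟩ := hf.exists_common_rate hg
  have hs : √ρ * √ρ = ρ := Real.mul_self_sqrt h0.le
  have hs0 : 0 < √ρ := Real.sqrt_pos.2 h0
  have hs1 : √ρ < 1 := by rw [Real.sqrt_lt' one_pos]; simpa using h1
  refine ⟨K * L, √ρ, mul_nonneg hK hL, hs0, hs1, fun n m j => ?_⟩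
  calc ‖f n j * g j m‖ ≤ ‖f n j‖ * ‖g j m‖ := norm_mul_le _ _
    _ ≤ (K * ρ ^ (n - j).natAbs) * (L * ρ ^ (j - m).natAbs) := by
        gcongr
        · exact h _ _
        · exact k _ _
    _ = K * L * √ρ ^ (2 * (n - j).natAbs + 2 * (j - m).natAbs) := by
        rw [pow_add, pow_mul, pow_mul, pow_two, hs]; ring
    _ ≤ K * L * √ρ ^ ((n - m).natAbs + (j - m).natAbs) := by
        refine mul_le_mul_of_nonneg_left ?_ (mul_nonneg hK hL)
        exact pow_le_pow_of_le_one hs0.le hs1.le (by omega)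
    _ = _ := by rw [pow_add]; ring

theorem ExpDecay.kernelComp {f g : ℤ → ℤ → R} (hf : ExpDecay f) (hg : ExpDecay g) :
    ExpDecay (kernelComp f g) := by
  obtain ⟨K, σ, -, h0, h1, h⟩ := hf.exists_norm_mul_le hg
  refine ⟨K * ∑' j : ℤ, σ ^ j.natAbs, σ, h0, h1, fun n k => ?_⟩
  have hsum := (((Equiv.subRight k).hasSum_iff (f := fun j : ℤ => σ ^ j.natAbs)).2
    (summable_pow_natAbs h0 h1).hasSum).mul_left (K * σ ^ (n - k).natAbs)
  refine (tsum_of_norm_bounded hsum (h n k)).trans_eq ?_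
  ring

theorem ExpDecay.summable_mul [CompleteSpace R] {f g : ℤ → ℤ → R} (hf : ExpDecay f) (hg : ExpDecay g) (n k : ℤ) :
    Summable (fun j => f n j * g j k) := by
  obtain ⟨K, σ, -, h0, h1, h⟩ := hf.exists_norm_mul_le hg
  refine Summable.of_norm_bounded ?_ (h n k)
  exact (((Equiv.subRight k).summable_iff (f := fun j : ℤ => σ ^ j.natAbs)).2
    (summable_pow_natAbs h0 h1)).mul_left _

/-! ### Terminating Neumann series -/

variable {D N : ℤ → R} {G₀ : ℤ → ℤ → R} {M : ℝ}

/-- The `m`-th term `G₀ (N G₀) ^ m` of the Neumann series of a perturbed Green kernel. -/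
noncomputable def neumannTerm (G₀ : ℤ → ℤ → R) (N : ℤ → R) : ℕ → ℤ → ℤ → R
  | 0 => G₀
  | m + 1 => kernelComp (fun n j => G₀ n (j + 1) * N j) (neumannTerm G₀ N m)

theorem expDecay_neumannTerm (h : ExpDecay G₀) (hN : ∀ n, ‖N n‖ ≤ M) (m : ℕ) :
    ExpDecay (neumannTerm G₀ N m) := by
  induction m with
  | zero => exact h
  | succ m ih => exact (h.shift_mul hN).kernelComp ih

variable [CompleteSpace R]

/-- Applying the unperturbed operator removes the leading `G₀` and leaves `N` times the previous
term. -/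
theorem neumannTerm_left (h : IsGreenKernel D G₀) (hN : ∀ n, ‖N n‖ ≤ M) (m : ℕ) (n k : ℤ) :
    neumannTerm G₀ N (m + 1) (n + 1) k =
      D n * neumannTerm G₀ N (m + 1) n k + N n * neumannTerm G₀ N m n k := by
  have hs := (h.decay.shift_mul hN).summable_mul (expDecay_neumannTerm h.decay hN m) n k
  have h1 : HasSum (fun j => if j = n then N n * neumannTerm G₀ N m n k else 0)
      (N n * neumannTerm G₀ N m n k) := hasSum_ite_eq n _
  refine ((hs.hasSum.mul_left (D n)).add h1).tsum_eq ▸ ?_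
  refine tsum_congr fun j => ?_
  change G₀ (n + 1) (j + 1) * N j * _ = _
  rw [h.left n (j + 1)]
  by_cases hj : j = n
  · subst hj; simp [add_mul, mul_assoc]
  · simp [hj, Ne.symm hj, mul_assoc]

/-- The recursion adds factors on the left, so cancelling the last `G₀` on the right takes an
induction on `m`. -/
theorem neumannTerm_right (h : IsGreenKernel D G₀) (hN : ∀ n, ‖N n‖ ≤ M) (m : ℕ) (n k : ℤ) :
    neumannTerm G₀ N (m + 1) n k =
      neumannTerm G₀ N (m + 1) n (k + 1) * D k + neumannTerm G₀ N m n (k + 1) * N k := by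
  induction m generalizing n k with
  | zero =>
    have hs := (h.decay.shift_mul hN).summable_mul h.decay n (k + 1)
    have h1 : HasSum (fun j => if j = k then G₀ n (k + 1) * N k else 0)
      (G₀ n (k + 1) * N k) := hasSum_ite_eq k _
    refine ((hs.hasSum.mul_right (D k)).add h1).tsum_eq ▸ ?_
    refine tsum_congr fun j => ?_
    change G₀ n (j + 1) * N j * G₀ j k = _
    rw [h.right j k]
    by_cases hj : j = k
    · subst hj; simp [mul_add, mul_assoc]
    · simp [hj, mul_assoc]
  | succ m ih =>
    have hs := (h.decay.shift_mul hN).summable_mul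
      (expDecay_neumannTerm h.decay hN (m + 1)) n (k + 1)
    have hs' := (h.decay.shift_mul hN).summable_mul
      (expDecay_neumannTerm h.decay hN m) n (k + 1)
    refine ((hs.hasSum.mul_right (D k)).add (hs'.hasSum.mul_right (N k))).tsum_eq ▸ ?_
    refine tsum_congr fun j => ?_
    rw [ih j k, mul_add, mul_assoc _ _ (D k), mul_assoc _ _ (N k)]

/-- If the Neumann series terminates, it is a Green kernel of the perturbed equation. -/
theorem isGreenKernel_neumann (h : IsGreenKernel D G₀) (hN : ∀ n, ‖N n‖ ≤ M) {d : ℕ}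
    (hd : ∀ n k, neumannTerm G₀ N d n k = 0) :
    IsGreenKernel (fun n => D n + N n)
      (fun n k => ∑ m ∈ Finset.range (d + 1), neumannTerm G₀ N m n k) where
  left n k := by
    have e : ∑ m ∈ Finset.range (d + 1), neumannTerm G₀ N m n k =
        ∑ m ∈ Finset.range d, neumannTerm G₀ N m n k := by
      rw [Finset.sum_range_succ, hd, add_zero]
    rw [add_mul]
    -- Only the sum multiplied by `N n` drops its vanishing last term; both sides then match term by
    -- term after an index shift.
    nth_rewrite 2 [e]
    rw [Finset.sum_range_succ', Finset.sum_range_succ']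
    rw [Finset.sum_congr rfl fun m _ => neumannTerm_left h hN m n k]
    rw [Finset.sum_add_distrib, ← Finset.mul_sum, ← Finset.mul_sum, mul_add]
    simp only [neumannTerm]
    rw [h.left n k]
    abel
  right n k := by
    have e : ∑ m ∈ Finset.range (d + 1), neumannTerm G₀ N m n (k + 1) =
        ∑ m ∈ Finset.range d, neumannTerm G₀ N m n (k + 1) := by
      rw [Finset.sum_range_succ, hd, add_zero]
    rw [mul_add]
    nth_rewrite 2 [e]
    rw [Finset.sum_range_succ', Finset.sum_range_succ']
    rw [Finset.sum_congr rfl fun m _ => neumannTerm_right h hN m n k]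
    rw [Finset.sum_add_distrib, ← Finset.sum_mul, ← Finset.sum_mul, add_mul]
    simp only [neumannTerm]
    rw [h.right n k]
    abel
  decay := ExpDecay.sum _ fun m => expDecay_neumannTerm h.decay hN m

end Kernel

/-! ### Fundamental matrices and Green kernels -/

namespace DifferenceSystem

variable {d : ℕ} {A : ℤ → Matrix (Fin d) (Fin d) ℝ}

theorem norm_smul_matrix (c : ℝ) (B : Matrix (Fin d) (Fin d) ℝ) : ‖c • B‖ = |c| * ‖B‖ := by
  let := Matrix.linftyOpNormedAlgebra (n := Fin d) (R := ℝ) (α := ℝ)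
  simpa using norm_smul c B

theorem abs_apply_le_norm (B : Matrix (Fin d) (Fin d) ℝ) (i j : Fin d) : |B i j| ≤ ‖B‖ := by
  rw [← Real.norm_eq_abs, ← coe_nnnorm, Matrix.linfty_opNorm_def, NNReal.coe_le_coe]
  exact (Finset.single_le_sum (f := fun j => ‖B i j‖₊) (fun _ _ => zero_le) (Finset.mem_univ j)).trans
    (Finset.le_sup (f := fun i => ∑ j, ‖B i j‖₊) (Finset.mem_univ i))

theorem inv_smul_matrix {c : ℝ} (hc : c ≠ 0) {B : Matrix (Fin d) (Fin d) ℝ} (hB : IsUnit B) :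
    (c • B)⁻¹ = c⁻¹ • B⁻¹ := by
  refine Matrix.inv_eq_left_inv ?_
  rw [smul_mul_smul_comm, inv_mul_cancel₀ hc,
    Matrix.nonsing_inv_mul _ ((Matrix.isUnit_iff_isUnit_det _).1 hB), one_smul]

theorem isUnit_smul_matrix {c : ℝ} (hc : c ≠ 0) {B : Matrix (Fin d) (Fin d) ℝ} (hB : IsUnit B) :
    IsUnit (c • B) := hB.smul (Units.mk0 c hc)

theorem eq_of_forall_succ_eq {α : Type*} {f : ℤ → α} (h : ∀ n, f (n + 1) = f n) (n : ℤ) :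
    f n = f 0 := by
  induction n using Int.induction_on with
  | zero => rfl
  | succ n ih => rw [h, ih]
  | pred n ih => rw [← ih, ← h (-n - 1), sub_add_cancel]

@[simp]
theorem fundamentalMatrix_zero : fundamentalMatrix A 0 = 1 := by
  simp [fundamentalMatrix, forwardProd]

theorem fundamentalMatrix_succ (hA : ∀ n, IsUnit (A n)) (n : ℤ) :
    fundamentalMatrix A (n + 1) = A n * fundamentalMatrix A n := by
  have hneg (m : ℕ) : fundamentalMatrix A (-m) = backwardProd A m := by
    rcases m with _ | m
    · simp [fundamentalMatrix, forwardProd, backwardProd]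
    · rw [fundamentalMatrix, if_neg (by omega)]
      congr 1
  rcases n.eq_nat_or_neg with ⟨m, rfl | rfl⟩
  · rw [fundamentalMatrix, fundamentalMatrix, if_pos (by omega), if_pos (by omega),
      Int.toNat_natCast, show ((m : ℤ) + 1).toNat = m + 1 by omega, forwardProd]
  · rcases m with _ | m
    · simp [fundamentalMatrix, forwardProd]
    · rw [show -((m + 1 : ℕ) : ℤ) + 1 = -(m : ℤ) by omega, hneg, hneg, backwardProd,
        Nat.cast_add, Nat.cast_one, ← mul_assoc,
        Matrix.mul_nonsing_inv _ ((Matrix.isUnit_iff_isUnit_det _).1 (hA _)), one_mul]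

theorem isUnit_fundamentalMatrix (hA : ∀ n, IsUnit (A n)) (n : ℤ) :
    IsUnit (fundamentalMatrix A n) := by
  induction n using Int.induction_on with
  | zero => simp
  | succ n ih => rw [fundamentalMatrix_succ hA]; exact (hA _).mul ih
  | pred n ih =>
    have := fundamentalMatrix_succ hA (-(n : ℤ) - 1)
    rw [sub_add_cancel] at this
    rw [this] at ih
    rw [Matrix.isUnit_iff_isUnit_det, Matrix.det_mul] at ih
    exact (Matrix.isUnit_iff_isUnit_det _).2 (isUnit_of_mul_isUnit_right ih)

theorem fundamentalMatrix_mul_inv (hA : ∀ n, IsUnit (A n)) (n : ℤ) :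
    fundamentalMatrix A n * (fundamentalMatrix A n)⁻¹ = 1 :=
  Matrix.mul_nonsing_inv _ ((Matrix.isUnit_iff_isUnit_det _).1 (isUnit_fundamentalMatrix hA n))

theorem fundamentalMatrix_inv_mul (hA : ∀ n, IsUnit (A n)) (n : ℤ) :
    (fundamentalMatrix A n)⁻¹ * fundamentalMatrix A n = 1 :=
  Matrix.nonsing_inv_mul _ ((Matrix.isUnit_iff_isUnit_det _).1 (isUnit_fundamentalMatrix hA n))

theorem inv_fundamentalMatrix_succ_mul (hA : ∀ n, IsUnit (A n)) (n : ℤ) :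
    (fundamentalMatrix A (n + 1))⁻¹ * A n = (fundamentalMatrix A n)⁻¹ := by
  rw [fundamentalMatrix_succ hA, Matrix.mul_inv_rev, mul_assoc,
    Matrix.nonsing_inv_mul _ ((Matrix.isUnit_iff_isUnit_det _).1 (hA n)), mul_one]

theorem fundamentalMatrix_smul (hA : ∀ n, IsUnit (A n)) {c : ℝ} (hc : c ≠ 0) (n : ℤ) :
    fundamentalMatrix (fun n => c • A n) n = c ^ n • fundamentalMatrix A n := by
  have hcA : ∀ n, IsUnit (c • A n) := fun n => isUnit_smul_matrix hc (hA n)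
  have key : ∀ n : ℤ, (c ^ n • fundamentalMatrix A n)⁻¹ *
      fundamentalMatrix (fun n => c • A n) n = 1 := by
    intro n
    refine (eq_of_forall_succ_eq (f := fun n : ℤ => (c ^ n • fundamentalMatrix A n)⁻¹ *
      fundamentalMatrix (fun n => c • A n) n) (fun m => ?_) n).trans (by simp)
    rw [inv_smul_matrix (zpow_ne_zero _ hc) (isUnit_fundamentalMatrix hA _),
      inv_smul_matrix (zpow_ne_zero _ hc) (isUnit_fundamentalMatrix hA _),
      fundamentalMatrix_succ hcA, smul_mul_assoc c, mul_smul_comm c, smul_mul_assoc,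
      ← mul_assoc, inv_fundamentalMatrix_succ_mul hA, smul_smul, smul_mul_assoc,
      zpow_add_one₀ hc, mul_inv, mul_left_comm, mul_inv_cancel₀ hc, mul_one]
  have hu := (isUnit_smul_matrix (zpow_ne_zero n hc) (isUnit_fundamentalMatrix hA n))
  rw [← mul_one (c ^ n • fundamentalMatrix A n), ← key n, ← mul_assoc,
    Matrix.mul_nonsing_inv _ ((Matrix.isUnit_iff_isUnit_det _).1 hu), one_mul]

/-- The Green kernel associated with a matrix `P`. -/
noncomputable def greenKernel (A : ℤ → Matrix (Fin d) (Fin d) ℝ) (P : Matrix (Fin d) (Fin d) ℝ)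
    (n k : ℤ) : Matrix (Fin d) (Fin d) ℝ :=
  if k ≤ n then fundamentalMatrix A n * P * (fundamentalMatrix A k)⁻¹
  else -(fundamentalMatrix A n * (1 - P) * (fundamentalMatrix A k)⁻¹)

theorem greenKernel_left (hA : ∀ n, IsUnit (A n)) (P : Matrix (Fin d) (Fin d) ℝ) (n k : ℤ) :
    greenKernel A P (n + 1) k = A n * greenKernel A P n k + if n + 1 = k then 1 else 0 := by
  unfold greenKernel
  rcases lt_trichotomy (n + 1) k with h | h | h
  · rw [if_neg (by omega), if_neg (by omega), if_neg (by omega), fundamentalMatrix_succ hA]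
    simp only [mul_neg, mul_assoc, add_zero]
  · subst h
    rw [if_pos le_rfl, if_neg (by omega), if_pos rfl, mul_neg, ← mul_assoc (A n),
      ← mul_assoc (A n), ← fundamentalMatrix_succ hA, mul_sub, mul_one, sub_mul,
      fundamentalMatrix_mul_inv hA]
    abel
  · rw [if_pos (by omega), if_pos (by omega), if_neg (by omega), fundamentalMatrix_succ hA]
    simp only [mul_assoc, add_zero]

theorem greenKernel_right (hA : ∀ n, IsUnit (A n)) (P : Matrix (Fin d) (Fin d) ℝ) (n k : ℤ) :
    greenKernel A P n k = greenKernel A P n (k + 1) * A k + if n = k then 1 else 0 := by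
  unfold greenKernel
  rcases lt_trichotomy n k with h | h | h
  · rw [if_neg (by omega), if_neg (by omega), if_neg (by omega), neg_mul, mul_assoc _ _ (A k),
      inv_fundamentalMatrix_succ_mul hA, add_zero]
  · subst h
    rw [if_pos le_rfl, if_neg (by omega), if_pos rfl, neg_mul, mul_assoc _ _ (A n),
      inv_fundamentalMatrix_succ_mul hA, mul_sub, mul_one, sub_mul, fundamentalMatrix_mul_inv hA]
    abel
  · rw [if_pos (by omega), if_pos (by omega), if_neg (by omega), mul_assoc _ _ (A k),
      inv_fundamentalMatrix_succ_mul hA, add_zero]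

theorem isGreenKernel_greenKernel (hA : ∀ n, IsUnit (A n)) {P : Matrix (Fin d) (Fin d) ℝ}
    (h : ExpDecay (greenKernel A P)) : IsGreenKernel A (greenKernel A P) :=
  ⟨greenKernel_left hA P, greenKernel_right hA P, h⟩

/-- Conjugating by the fundamental matrix and adding `1` where `n < k` removes the dynamics and the
jump: the result `h` is constant in both variables, and its value at `(0, 0)` is the projection. -/
theorem eq_greenKernel (hA : ∀ n, IsUnit (A n)) {G : ℤ → ℤ → Matrix (Fin d) (Fin d) ℝ}
    (hG : IsGreenKernel A G) : G = greenKernel A (G 0 0) := by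
  set X := fundamentalMatrix A with hX
  let h : ℤ → ℤ → Matrix (Fin d) (Fin d) ℝ :=
    fun n k => (X n)⁻¹ * G n k * X k + if k ≤ n then 0 else 1
  have h1 : ∀ n k, h (n + 1) k = h n k := by
    intro n k
    simp only [h]
    rw [hG.left, mul_add, ← mul_assoc, inv_fundamentalMatrix_succ_mul hA, add_mul, add_assoc]
    congr 1
    rcases lt_trichotomy (n + 1) k with h | h | h
    · rw [if_neg (by omega), if_neg (by omega), if_neg (by omega)]; simp
    · subst h
      rw [if_pos rfl, if_pos le_rfl, if_neg (by omega), mul_one, fundamentalMatrix_inv_mul hA,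
        add_zero]
    · rw [if_neg (by omega), if_pos (by omega), if_pos (by omega)]; simp
  have h2 : ∀ n k, h n (k + 1) = h n k := by
    intro n k
    simp only [h]
    rw [hG.right n k, hX, fundamentalMatrix_succ hA, mul_add, add_mul, ← mul_assoc, ← mul_assoc,
      add_assoc]
    congr 1
    rcases lt_trichotomy n k with h | h | h
    · rw [if_neg (by omega), if_neg (by omega), if_neg (by omega)]; simp
    · subst h
      rw [if_pos rfl, if_pos le_rfl, if_neg (by omega), mul_one, fundamentalMatrix_inv_mul hA,
        add_zero]
    · rw [if_pos (by omega), if_neg (by omega), if_pos (by omega)]; simp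
  have h3 : ∀ n k, h n k = G 0 0 := fun n k =>
    (eq_of_forall_succ_eq (f := fun n => h n k) (fun n => h1 n k) n).trans
      ((eq_of_forall_succ_eq (f := fun k => h 0 k) (fun k => h2 0 k) k).trans (by simp [h, hX]))
  have h4 : ∀ n k, X n * ((X n)⁻¹ * G n k * X k) * (X k)⁻¹ = G n k := by
    intro n k
    rw [← mul_assoc, ← mul_assoc, fundamentalMatrix_mul_inv hA, one_mul, mul_assoc,
      fundamentalMatrix_mul_inv hA, mul_one]
  funext n k
  rw [greenKernel]
  split_ifs with hnk
  · have := h3 n k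
    simp only [h, if_pos hnk, add_zero] at this
    rw [← this, ← hX, h4]
  · have := h3 n k
    simp only [h, if_neg hnk] at this
    rw [← this, ← hX, sub_add_cancel_right, mul_neg, neg_mul, neg_neg, h4]

/-! ### Uniqueness of the projection and Green kernels versus dichotomies -/

theorem eq_zero_of_norm_le_geometric {R : Type*} [NormedRing R] {a : R} {K ρ : ℝ} (h0 : 0 ≤ ρ)
    (h1 : ρ < 1) (h : ∀ n : ℕ, ‖a‖ ≤ K * ρ ^ n) : a = 0 := by
  have := (tendsto_pow_atTop_nhds_zero_of_lt_one h0 h1).const_mul K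
  rw [mul_zero] at this
  exact norm_le_zero_iff.1 (ge_of_tendsto' this h)

/-- The product factors through time `n + 1` into two decaying kernel values, for every `n`. The
case `P = Q` shows that decay alone forces `P` to be idempotent. -/
theorem one_sub_mul_eq_zero (hA : ∀ n, IsUnit (A n)) {P Q : Matrix (Fin d) (Fin d) ℝ}
    (hP : ExpDecay (greenKernel A P)) (hQ : ExpDecay (greenKernel A Q)) : (1 - P) * Q = 0 := by
  obtain ⟨K, L, ρ, hK, hL, h0, h1, h, k⟩ := hP.exists_common_rate hQ
  refine eq_zero_of_norm_le_geometric (K := K * L) h0.le h1 fun n => ?_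
  have e : (1 - P) * Q = -(greenKernel A P 0 ((n : ℤ) + 1) * greenKernel A Q ((n : ℤ) + 1) 0) := by
    rw [greenKernel, greenKernel, if_neg (by omega), if_pos (by omega), fundamentalMatrix_zero,
      inv_one, mul_one, one_mul, neg_mul, neg_neg, mul_assoc, ← mul_assoc _ _ Q,
      fundamentalMatrix_inv_mul hA, one_mul]
  rw [e, norm_neg]
  calc _ ≤ _ := norm_mul_le _ _
    _ ≤ (K * ρ ^ n) * (L * 1) := by
      gcongr
      · refine (h _ _).trans ?_
        exact mul_le_mul_of_nonneg_left (pow_le_pow_of_le_one h0.le h1.le (by omega)) hK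
      · refine (k _ _).trans ?_
        exact mul_le_mul_of_nonneg_left (pow_le_one₀ h0.le h1.le) hL
    _ = _ := by ring

theorem mul_one_sub_eq_zero (hA : ∀ n, IsUnit (A n)) {P Q : Matrix (Fin d) (Fin d) ℝ}
    (hP : ExpDecay (greenKernel A P)) (hQ : ExpDecay (greenKernel A Q)) : P * (1 - Q) = 0 := by
  obtain ⟨K, L, ρ, hK, hL, h0, h1, h, k⟩ := hP.exists_common_rate hQ
  refine eq_zero_of_norm_le_geometric (K := K * L) h0.le h1 fun n => ?_
  have e : P * (1 - Q) = -(greenKernel A P 0 (-(n : ℤ) - 1) * greenKernel A Q (-(n : ℤ) - 1) 0) := by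
    rw [greenKernel, greenKernel, if_pos (by omega), if_neg (by omega), fundamentalMatrix_zero,
      inv_one, mul_one, one_mul, mul_neg, neg_neg, mul_assoc, ← mul_assoc _ _ (1 - Q),
      fundamentalMatrix_inv_mul hA, one_mul]
  rw [e, norm_neg]
  calc _ ≤ _ := norm_mul_le _ _
    _ ≤ (K * ρ ^ n) * (L * 1) := by
      gcongr
      · refine (h _ _).trans ?_
        exact mul_le_mul_of_nonneg_left (pow_le_pow_of_le_one h0.le h1.le (by omega)) hK
      · refine (k _ _).trans ?_
        exact mul_le_mul_of_nonneg_left (pow_le_one₀ h0.le h1.le) hL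
    _ = _ := by ring

theorem dichotomy_projection_unique (hA : ∀ n, IsUnit (A n)) {P Q : Matrix (Fin d) (Fin d) ℝ}
    (hP : ExpDecay (greenKernel A P)) (hQ : ExpDecay (greenKernel A Q)) : P = Q := by
  have h1 := one_sub_mul_eq_zero hA hP hQ
  have h2 := mul_one_sub_eq_zero hA hP hQ
  rw [sub_mul, one_mul, sub_eq_zero] at h1
  rw [mul_sub, mul_one, sub_eq_zero] at h2
  rw [h1, ← h2]

theorem hasExpDichotomy_iff_exists_expDecay (hA : ∀ n, IsUnit (A n)) :
    HasExpDichotomy A ↔ ∃ P, ExpDecay (greenKernel A P) := by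
  constructor
  · rintro ⟨K, ρ, P, -, h0, h1, -, hs, hu⟩
    refine ⟨P, K, ρ, h0, h1, fun n k => ?_⟩
    rw [greenKernel, ← zpow_natCast]
    split_ifs with h
    · rw [Int.natCast_natAbs, abs_of_nonneg (by omega)]
      exact hs n k h
    · rw [norm_neg, Int.natCast_natAbs, abs_sub_comm, abs_of_nonneg (by omega)]
      exact hu n k (by omega)
  · rintro ⟨P, hP⟩
    have hPP := one_sub_mul_eq_zero hA hP hP
    obtain ⟨K, ρ, h0, h1, h⟩ := hP
    have hK : 0 ≤ K := by simpa using (norm_nonneg _).trans (h 0 0)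
    have h2 : ∀ n k : ℤ, k ≤ n →
        ‖fundamentalMatrix A n * P * (fundamentalMatrix A k)⁻¹‖ ≤ K * ρ ^ (n - k) := by
      intro n k hnk
      have := h n k
      rwa [greenKernel, if_pos hnk, ← zpow_natCast, Int.natCast_natAbs,
        abs_of_nonneg (by omega)] at this
    have hone : 0 ≤ ‖(1 : Matrix (Fin d) (Fin d) ℝ)‖ := norm_nonneg _
    -- At `n = k` the kernel controls only the `P` part, so the complementary bound there costs
    -- `‖1‖`; the last `1` ensures a constant at least `1` even when `d = 0`.
    refine ⟨K + ‖(1 : Matrix (Fin d) (Fin d) ℝ)‖ + 1, ρ, P, by linarith, h0, h1, ?_,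
      fun n k hnk => ?_, fun n k hnk => ?_⟩
    · rw [sub_mul, one_mul, sub_eq_zero] at hPP
      rw [pow_two, ← hPP]
    · refine (h2 n k hnk).trans ?_
      gcongr
      linarith
    · rcases hnk.eq_or_lt with rfl | hlt
      · rw [mul_sub, mul_one, sub_mul, fundamentalMatrix_mul_inv hA]
        have := h2 n n le_rfl
        have h3 := norm_sub_le 1 (fundamentalMatrix A n * P * (fundamentalMatrix A n)⁻¹)
        simp only [sub_self, zpow_zero, mul_one] at this ⊢
        linarith
      · have := h n k
        rw [greenKernel, if_neg (by omega), norm_neg, ← zpow_natCast, Int.natCast_natAbs,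
          abs_sub_comm, abs_of_nonneg (by omega)] at this
        refine this.trans ?_
        gcongr
        linarith

theorem hasExpDichotomy_iff_exists_isGreenKernel (hA : ∀ n, IsUnit (A n)) :
    HasExpDichotomy A ↔ ∃ G, IsGreenKernel A G := by
  rw [hasExpDichotomy_iff_exists_expDecay hA]
  constructor
  · rintro ⟨P, hP⟩
    exact ⟨_, isGreenKernel_greenKernel hA hP⟩
  · rintro ⟨G, hG⟩
    exact ⟨G 0 0, eq_greenKernel hA hG ▸ hG.decay⟩

/-! ### Dependence on the spectral parameter -/

theorem greenKernel_smul (hA : ∀ n, IsUnit (A n)) {c : ℝ} (hc : c ≠ 0)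
    (P : Matrix (Fin d) (Fin d) ℝ) (n k : ℤ) :
    greenKernel (fun n => c • A n) P n k = c ^ (n - k) • greenKernel A P n k := by
  rw [greenKernel, greenKernel, fundamentalMatrix_smul hA hc, fundamentalMatrix_smul hA hc,
    inv_smul_matrix (zpow_ne_zero _ hc) (isUnit_fundamentalMatrix hA _), zpow_sub₀ hc,
    div_eq_mul_inv]
  split_ifs <;> simp [smul_smul, mul_comm]

/-- Scaling by `c` multiplies the kernel by `c ^ (n - k)`, harmless while `c * ρ` and `c⁻¹ * ρ` stay
below `1`; the projection is unchanged. -/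
theorem ExpDecay.eventually_smul (hA : ∀ n, IsUnit (A n)) {P : Matrix (Fin d) (Fin d) ℝ}
    (h : ExpDecay (greenKernel A P)) :
    ∀ᶠ c : ℝ in nhds 1, ExpDecay (greenKernel (fun n => c • A n) P) := by
  obtain ⟨K, ρ, h0, h1, h⟩ := h
  have hK : 0 ≤ K := by simpa using (norm_nonneg _).trans (h 0 0)
  have e1 : ∀ᶠ c : ℝ in nhds 1, c * ρ < 1 :=
    (continuous_id.mul continuous_const).continuousAt.eventually_lt continuousAt_const (by simpa)
  have e2 : ∀ᶠ c : ℝ in nhds 1, ρ < c := lt_mem_nhds h1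
  filter_upwards [e1, e2] with c hc1 hc2
  have hc : 0 < c := h0.trans hc2
  have hc3 : c⁻¹ * ρ < 1 := by rwa [inv_mul_lt_one₀ hc]
  refine ⟨K, max (c * ρ) (c⁻¹ * ρ), lt_max_of_lt_left (by positivity), max_lt hc1 hc3,
    fun n k => ?_⟩
  rw [greenKernel_smul hA hc.ne', norm_smul_matrix, abs_of_pos (by positivity)]
  refine (mul_le_mul_of_nonneg_left (h n k) (by positivity)).trans ?_
  rw [mul_left_comm]
  refine mul_le_mul_of_nonneg_left ?_ hK
  rcases le_total k n with hnk | hnk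
  · obtain ⟨m, rfl⟩ := Int.le.dest hnk
    rw [add_sub_cancel_left, zpow_natCast, Int.natAbs_natCast, ← mul_pow]
    exact pow_le_pow_left₀ (by positivity) (le_max_left _ _) _
  · obtain ⟨m, rfl⟩ := Int.le.dest hnk
    rw [sub_add_cancel_left, zpow_neg, zpow_natCast, Int.natAbs_neg, Int.natAbs_natCast,
      ← inv_pow, ← mul_pow]
    exact pow_le_pow_left₀ (by positivity) (le_max_right _ _) _

theorem isOpen_setOf_expDecay (hA : ∀ n, IsUnit (A n)) (P : Matrix (Fin d) (Fin d) ℝ) :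
    IsOpen {μ : ℝ | 0 < μ ∧ ExpDecay (greenKernel (fun n => μ⁻¹ • A n) P)} := by
  rw [isOpen_iff_mem_nhds]
  rintro μ ⟨hμ, h⟩
  have h1 := ExpDecay.eventually_smul (fun n => isUnit_smul_matrix (inv_ne_zero hμ.ne') (hA n)) h
  have h2 : Filter.Tendsto (fun ν : ℝ => ν⁻¹ * μ) (nhds μ) (nhds 1) := by
    have : ContinuousAt (fun ν : ℝ => ν⁻¹ * μ) μ :=
      (continuousAt_inv₀ hμ.ne').mul continuousAt_const
    simpa [ContinuousAt, hμ.ne'] using this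
  filter_upwards [h2.eventually h1, lt_mem_nhds hμ] with ν hν hν0
  refine ⟨hν0, ?_⟩
  simpa [smul_smul, mul_assoc, hμ.ne'] using hν

/-- On a connected set of parameters in the resolvent, the dichotomy projection is constant. -/
theorem expDecay_of_isPreconnected (hA : ∀ n, IsUnit (A n)) {S : Set ℝ} (hS : IsPreconnected S)
    (hpos : ∀ μ ∈ S, 0 < μ) (hdich : ∀ μ ∈ S, HasExpDichotomy (fun n => μ⁻¹ • A n))
    {P : Matrix (Fin d) (Fin d) ℝ} {μ₀ : ℝ} (hμ₀ : μ₀ ∈ S)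
    (h₀ : ExpDecay (greenKernel (fun n => μ₀⁻¹ • A n) P)) {μ : ℝ} (hμ : μ ∈ S) :
    ExpDecay (greenKernel (fun n => μ⁻¹ • A n) P) := by
  have hu : ∀ ν : ℝ, 0 < ν → ∀ n, IsUnit (ν⁻¹ • A n) :=
    fun ν hν n => isUnit_smul_matrix (inv_ne_zero hν.ne') (hA n)
  -- The sets `U Q` are open, pairwise disjoint by uniqueness of the projection, and cover `S`.
  let U (Q : Matrix (Fin d) (Fin d) ℝ) : Set ℝ :=
    {μ : ℝ | 0 < μ ∧ ExpDecay (greenKernel (fun n => μ⁻¹ • A n) Q)}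
  have hV : IsOpen (⋃ Q : {Q // Q ≠ P}, U Q) :=
    isOpen_iUnion fun Q => isOpen_setOf_expDecay hA Q
  have hdisj : U P ∩ ⋃ Q : {Q // Q ≠ P}, U Q = ∅ := by
    rw [Set.eq_empty_iff_forall_notMem]
    rintro ν ⟨⟨hν, h1⟩, h2⟩
    obtain ⟨⟨Q, hQ⟩, -, h2⟩ := Set.mem_iUnion.1 h2
    exact hQ (dichotomy_projection_unique (hu ν hν) h2 h1)
  have hcov : S ⊆ U P ∪ ⋃ Q : {Q // Q ≠ P}, U Q := by
    intro ν hν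
    obtain ⟨Q, hQ⟩ := (hasExpDichotomy_iff_exists_expDecay (hu ν (hpos ν hν))).1 (hdich ν hν)
    by_cases h : Q = P
    · exact Or.inl ⟨hpos ν hν, h ▸ hQ⟩
    · exact Or.inr (Set.mem_iUnion.2 ⟨⟨Q, h⟩, hpos ν hν, hQ⟩)
  rcases isPreconnected_iff_subset_of_disjoint.1 hS _ _ (isOpen_setOf_expDecay hA P) hV hcov
    (by rw [hdisj, Set.inter_empty]) with h | h
  · exact (h hμ).2
  · have : μ₀ ∈ U P ∩ ⋃ Q : {Q // Q ≠ P}, U Q := ⟨⟨hpos _ hμ₀, h₀⟩, h hμ₀⟩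
    rw [hdisj] at this
    exact this.elim

theorem expDecay_greenKernel_one (hA : ∀ n, IsUnit (A n)) (h : ∀ n, ‖A n‖ ≤ 1 / 2) :
    ExpDecay (greenKernel A 1) := by
  refine ⟨‖(1 : Matrix (Fin d) (Fin d) ℝ)‖, 1 / 2, by norm_num, by norm_num, fun n k => ?_⟩
  rw [greenKernel]
  split_ifs with hnk
  · obtain ⟨m, rfl⟩ := Int.le.dest hnk
    rw [add_sub_cancel_left, Int.natAbs_natCast, mul_one]
    clear hnk
    induction m with
    | zero => simp [fundamentalMatrix_mul_inv hA]
    | succ m ih =>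
      rw [Nat.cast_succ, ← add_assoc, fundamentalMatrix_succ hA, mul_assoc]
      refine (norm_mul_le _ _).trans ((mul_le_mul (h _) ih (norm_nonneg _) (by norm_num)).trans_eq ?_)
      ring
  · simp only [sub_self, mul_zero, zero_mul, neg_zero, norm_zero]
    positivity

theorem expDecay_greenKernel_zero (hA : ∀ n, IsUnit (A n)) (h : ∀ n, ‖(A n)⁻¹‖ ≤ 1 / 2) :
    ExpDecay (greenKernel A 0) := by
  refine ⟨‖(1 : Matrix (Fin d) (Fin d) ℝ)‖, 1 / 2, by norm_num, by norm_num, fun n k => ?_⟩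
  rw [greenKernel]
  split_ifs with hnk
  · simp only [mul_zero, zero_mul, norm_zero]
    positivity
  · obtain ⟨m, rfl⟩ := Int.le.dest (not_le.1 hnk).le
    rw [sub_add_cancel_left, Int.natAbs_neg, Int.natAbs_natCast, norm_neg, sub_zero, mul_one]
    clear hnk
    induction m with
    | zero => simp [fundamentalMatrix_mul_inv hA]
    | succ m ih =>
      rw [Nat.cast_succ, ← add_assoc, fundamentalMatrix_succ hA, Matrix.mul_inv_rev, ← mul_assoc]
      refine (norm_mul_le _ _).trans ((mul_le_mul ih (h _) (norm_nonneg _) (by positivity)).trans_eq ?_)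
      ring

end DifferenceSystem

/-! ### Triangular systems and their diagonals -/

namespace DifferenceSystem

variable {d : ℕ} {C : ℤ → Matrix (Fin d) (Fin d) ℝ}

theorem completeSpace_matrix : @CompleteSpace (Matrix (Fin d) (Fin d) ℝ)
    (Matrix.linftyOpNormedRing (n := Fin d) (α := ℝ)).toMetricSpace.toUniformSpace := by
  let := Matrix.linftyOpNormedAlgebra (n := Fin d) (R := ℝ) (α := ℝ)
  exact FiniteDimensional.complete ℝ _

theorem mul_apply_diag {A B : Matrix (Fin d) (Fin d) ℝ} (hA : A.BlockTriangular id)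
    (hB : B.BlockTriangular id) (i : Fin d) : (A * B) i i = A i i * B i i := by
  rw [Matrix.mul_apply]
  refine Finset.sum_eq_single i (fun j _ hj => ?_) (by simp)
  rcases lt_or_gt_of_ne hj with h | h
  · rw [hA h, zero_mul]
  · rw [hB h, mul_zero]

theorem blockTriangular_inv {A : Matrix (Fin d) (Fin d) ℝ} (hu : IsUnit A)
    (hA : A.BlockTriangular id) : A⁻¹.BlockTriangular id := by
  obtain ⟨_⟩ := hu.nonempty_invertible
  exact Matrix.blockTriangular_inv_of_blockTriangular hA

theorem blockTriangular_fundamentalMatrix (hu : ∀ n, IsUnit (C n))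
    (hC : ∀ n, (C n).BlockTriangular id) (n : ℤ) :
    (fundamentalMatrix C n).BlockTriangular id := by
  induction n using Int.induction_on with
  | zero => simpa using Matrix.blockTriangular_one
  | succ n ih => rw [fundamentalMatrix_succ hu]; exact (hC _).mul ih
  | pred n ih =>
    have := fundamentalMatrix_succ hu (-(n : ℤ) - 1)
    rw [sub_add_cancel] at this
    have h2 : fundamentalMatrix C (-(n : ℤ) - 1) =
        (C (-(n : ℤ) - 1))⁻¹ * fundamentalMatrix C (-n) := by
      rw [this, ← mul_assoc, Matrix.nonsing_inv_mul _ ((Matrix.isUnit_iff_isUnit_det _).1 (hu _)),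
        one_mul]
    rw [h2]
    exact (blockTriangular_inv (hu _) (hC _)).mul ih

theorem blockTriangular_greenKernel (hu : ∀ n, IsUnit (C n))
    (hC : ∀ n, (C n).BlockTriangular id) {P : Matrix (Fin d) (Fin d) ℝ}
    (hP : P.BlockTriangular id) (n k : ℤ) : (greenKernel C P n k).BlockTriangular id := by
  have h1 := blockTriangular_fundamentalMatrix hu hC n
  have h2 := blockTriangular_inv (isUnit_fundamentalMatrix hu k)
    (blockTriangular_fundamentalMatrix hu hC k)
  rw [greenKernel]
  split_ifs
  · exact (h1.mul hP).mul h2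
  · exact ((h1.mul (Matrix.blockTriangular_one.sub hP)).mul h2).neg

theorem isUnit_apply_diag {A : Matrix (Fin d) (Fin d) ℝ} (hu : IsUnit A)
    (hA : A.BlockTriangular id) (i : Fin d) : A i i ≠ 0 := by
  intro h
  have := mul_apply_diag hA (blockTriangular_inv hu hA) i
  rw [Matrix.mul_nonsing_inv _ ((Matrix.isUnit_iff_isUnit_det _).1 hu), h] at this
  simp at this

theorem scalarSystem_eq_diagonal (c : ℤ → ℝ) (n : ℤ) :
    scalarSystem c n = Matrix.diagonal fun _ => c n := by
  ext i j
  simp [scalarSystem, Subsingleton.elim i j]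

theorem isUnit_scalarSystem {c : ℤ → ℝ} (hc : ∀ n, c n ≠ 0) (n : ℤ) :
    IsUnit (scalarSystem c n) := by
  rw [Matrix.isUnit_iff_isUnit_det]
  simpa [scalarSystem] using hc n

theorem hasExpDichotomy_scalarSystem_iff {c : ℤ → ℝ} (hc : ∀ n, c n ≠ 0) :
    HasExpDichotomy (scalarSystem c) ↔ ∃ g, IsGreenKernel c g := by
  rw [hasExpDichotomy_iff_exists_isGreenKernel (isUnit_scalarSystem hc)]
  constructor
  · rintro ⟨G, hG⟩
    refine ⟨fun n k => G n k 0 0, fun n k => ?_, fun n k => ?_,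
      hG.decay.of_norm_le fun n k => abs_apply_le_norm _ _ _⟩
    · have := congrFun (congrFun (hG.left n k) 0) 0
      split_ifs at this ⊢ <;> simpa [scalarSystem, Matrix.mul_apply] using this
    · have := congrFun (congrFun (hG.right n k) 0) 0
      split_ifs at this ⊢ <;> simpa [scalarSystem, Matrix.mul_apply] using this
  · rintro ⟨g, hg⟩
    refine ⟨fun n k => Matrix.diagonal fun _ => g n k, fun n k => ?_, fun n k => ?_,
      hg.decay.of_norm_le fun n k => ?_⟩
    · rw [scalarSystem_eq_diagonal, hg.left, Matrix.diagonal_mul_diagonal]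
      split_ifs <;> simp [← Matrix.diagonal_one, Matrix.diagonal_add]
    · rw [scalarSystem_eq_diagonal, hg.right, Matrix.diagonal_mul_diagonal]
      split_ifs <;> simp [← Matrix.diagonal_one, Matrix.diagonal_add]
    · rw [Matrix.linfty_opNorm_diagonal]
      exact pi_norm_const_le _

/-- A dichotomy with upper triangular projection passes to the diagonal entries. -/
theorem hasExpDichotomy_diag (hu : ∀ n, IsUnit (C n)) (hC : ∀ n, (C n).BlockTriangular id)
    {P : Matrix (Fin d) (Fin d) ℝ} (hP : P.BlockTriangular id)
    (h : ExpDecay (greenKernel C P)) (i : Fin d) :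
    HasExpDichotomy (scalarSystem fun n => C n i i) := by
  rw [hasExpDichotomy_scalarSystem_iff fun n => isUnit_apply_diag (hu n) (hC n) i]
  have hT := blockTriangular_greenKernel hu hC hP
  refine ⟨fun n k => greenKernel C P n k i i, fun n k => ?_, fun n k => ?_,
    h.of_norm_le fun n k => abs_apply_le_norm _ _ _⟩
  · rw [greenKernel_left hu, Matrix.add_apply, mul_apply_diag (hC n) (hT n k)]
    split_ifs <;> simp
  · rw [greenKernel_right hu, Matrix.add_apply, mul_apply_diag (hT n (k + 1)) (hC k)]
    split_ifs <;> simp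

theorem isGreenKernel_diagonal {c : Fin d → ℤ → ℝ} {g : Fin d → ℤ → ℤ → ℝ}
    (h : ∀ i, IsGreenKernel (c i) (g i)) :
    IsGreenKernel (fun n => Matrix.diagonal fun i => c i n)
      (fun n k => Matrix.diagonal fun i => g i n k) where
  left n k := by
    simp_rw [(h _).left n k, Matrix.diagonal_mul_diagonal]
    split_ifs <;> simp [← Matrix.diagonal_one, Matrix.diagonal_add]
  right n k := by
    rw [Matrix.diagonal_mul_diagonal, funext fun i => (h i).right n k]
    split_ifs <;> simp [← Matrix.diagonal_one, Matrix.diagonal_add]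
  decay := by
    have h1 : ∀ i, ExpDecay fun n k =>
        (Matrix.diagonal (Pi.single i (g i n k)) : Matrix (Fin d) (Fin d) ℝ) := fun i =>
      (h i).decay.of_norm_le fun n k => by
        rw [Matrix.linfty_opNorm_diagonal, Pi.norm_single]
    convert ExpDecay.sum Finset.univ h1 using 3 with n k
    ext p q
    simp [Matrix.sum_apply, Matrix.diagonal_apply, Pi.single_apply]

/-- Each factor `N` moves the support one superdiagonal further up while `G₀` never lowers it, so
nothing remains at `m = d`. -/
theorem neumannTerm_apply_eq_zero {G₀ : ℤ → ℤ → Matrix (Fin d) (Fin d) ℝ}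
    {N : ℤ → Matrix (Fin d) (Fin d) ℝ} {M : ℝ} (hG₀ : ExpDecay G₀) (hM : ∀ n, ‖N n‖ ≤ M)
    (hG : ∀ n k, (G₀ n k).BlockTriangular id) (hN : ∀ n p q, q ≤ p → N n p q = 0) (m : ℕ)
    (n k : ℤ) (p q : Fin d) (hpq : (q : ℕ) < p + m) : neumannTerm G₀ N m n k p q = 0 := by
  have := completeSpace_matrix (d := d)
  induction m generalizing n k p q with
  | zero => exact hG n k (by simpa using hpq)
  | succ m ih =>
    -- Evaluation at an entry is continuous and additive, so it commutes with the infinite sum.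
    let e : Matrix (Fin d) (Fin d) ℝ →+ ℝ :=
      { toFun := fun B => B p q, map_zero' := rfl, map_add' := fun _ _ => rfl }
    have he : Continuous e :=
      AddMonoidHomClass.continuous_of_bound e 1 fun B => by
        rw [one_mul]
        exact abs_apply_le_norm B p q
    have hs := ((hG₀.shift_mul hM).summable_mul (expDecay_neumannTerm hG₀ hM m) n k).hasSum
    refine (hs.map e he).unique ?_
    convert hasSum_zero using 1
    funext j
    change (G₀ n (j + 1) * N j * neumannTerm G₀ N m j k) p q = 0
    rw [mul_assoc, Matrix.mul_apply]
    refine Finset.sum_eq_zero fun r _ => ?_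
    rcases lt_or_ge r p with hr | hr
    · rw [hG n (j + 1) hr, zero_mul]
    · rw [Matrix.mul_apply, Finset.sum_eq_zero, mul_zero]
      intro s _
      rcases le_or_gt s r with hs | hs
      · rw [hN j r s hs, zero_mul]
      · rw [ih j k s q (by omega), mul_zero]

/-- Dichotomies of all diagonal entries yield a dichotomy of the triangular system. -/
theorem hasExpDichotomy_of_diag (hu : ∀ n, IsUnit (C n)) (hC : ∀ n, (C n).BlockTriangular id)
    {M : ℝ} (hM : ∀ n, ‖C n‖ ≤ M)
    (h : ∀ i, HasExpDichotomy (scalarSystem fun n => C n i i)) : HasExpDichotomy C := by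
  have := completeSpace_matrix (d := d)
  have h' := fun i =>
    (hasExpDichotomy_scalarSystem_iff fun n => isUnit_apply_diag (hu n) (hC n) i).1 (h i)
  choose g hg using h'
  have hD := isGreenKernel_diagonal hg
  let N : ℤ → Matrix (Fin d) (Fin d) ℝ := fun n => C n - Matrix.diagonal fun i => C n i i
  have hN : ∀ n, ‖N n‖ ≤ M + M := by
    intro n
    refine (norm_sub_le _ _).trans (add_le_add (hM n) ?_)
    rw [Matrix.linfty_opNorm_diagonal]
    refine ((pi_norm_le_iff_of_nonneg (norm_nonneg (C n))).2 fun i => ?_).trans (hM n)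
    exact abs_apply_le_norm _ _ _
  have hN0 : ∀ n p q, q ≤ p → N n p q = 0 := by
    intro n p q hqp
    rcases hqp.eq_or_lt with rfl | hlt
    · simp [N]
    · simp [N, Matrix.diagonal_apply_ne _ hlt.ne', hC n (show id q < id p from hlt)]
  have hG := isGreenKernel_neumann hD hN (d := d) fun n k => by
    ext p q
    exact neumannTerm_apply_eq_zero hD.decay hN (fun n k => Matrix.blockTriangular_diagonal _)
      hN0 d n k p q (by omega)
  rw [hasExpDichotomy_iff_exists_isGreenKernel hu]
  have hC' : C = fun n => (Matrix.diagonal fun i => C n i i) + N n := by simp [N]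
  rw [← hC'] at hG
  exact ⟨_, hG⟩

end DifferenceSystem

/-! ### The spectrum as a union -/

open DifferenceSystem in
theorem proposition3 (d : ℕ) (C : ℤ → Matrix (Fin d) (Fin d) ℝ)
    (hinv : ∀ n : ℤ, IsUnit (C n))
    (hbdd : ∃ M : ℝ, ∀ n : ℤ, ‖C n‖ ≤ M)
    (hbdd_inv : ∃ M : ℝ, ∀ n : ℤ, ‖(C n)⁻¹‖ ≤ M)
    (htri : ∀ (n : ℤ) (i j : Fin d), j < i → C n i j = 0)
    (a b : ℝ) (hab : a ≤ b)
    (hspec : DifferenceSystem.sackerSellSpectrum C = Set.Icc a b) :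
    DifferenceSystem.sackerSellSpectrum C =
      ⋃ i : Fin d,
        DifferenceSystem.sackerSellSpectrum
          (DifferenceSystem.scalarSystem fun n => C n i i) := by
  obtain ⟨M, hM⟩ := hbdd
  obtain ⟨L, hL⟩ := hbdd_inv
  have hscalar : ∀ (μ : ℝ) (i : Fin d), (fun n => μ⁻¹ • scalarSystem (fun n => C n i i) n) =
      scalarSystem fun n => (μ⁻¹ • C n) i i := by
    intro μ i
    funext n
    ext p q
    simp [scalarSystem]
  have hu : ∀ μ : ℝ, 0 < μ → ∀ n, IsUnit (μ⁻¹ • C n) :=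
    fun μ hμ n => isUnit_smul_matrix (inv_ne_zero hμ.ne') (hinv n)
  have hT : ∀ μ : ℝ, ∀ n, (μ⁻¹ • C n).BlockTriangular id := fun μ n i j hij => by
    simp [htri n i j hij]
  have hres : ∀ μ : ℝ, 0 < μ → μ ∉ Set.Icc a b → HasExpDichotomy fun n => μ⁻¹ • C n := by
    intro μ hμ h
    by_contra hc
    exact h (hspec ▸ ⟨hμ, hc⟩)
  have ha : 0 < a := by
    have : a ∈ sackerSellSpectrum C := hspec ▸ Set.left_mem_Icc.2 hab
    exact this.1
  have hproj : ∀ μ : ℝ, 0 < μ → μ ∉ Set.Icc a b → ∃ P : Matrix (Fin d) (Fin d) ℝ,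
      P.BlockTriangular id ∧ ExpDecay (greenKernel (fun n => μ⁻¹ • C n) P) := by
    intro μ hμ h
    rcases lt_or_ge μ a with hlt | hge
    -- For `μ₀ < 1 / (2 * (|L| + 1))` the inverses of `μ₀⁻¹ • C n` have norm at most `1 / 2`, so the
    -- projection on `(0, a)` is `0`.
    · have hM' : 0 < 2 * (|L| + 1) := by positivity
      obtain ⟨μ₀, h0, h1⟩ := exists_between (lt_min ha (inv_pos.2 hM'))
      refine ⟨0, Matrix.blockTriangular_zero, expDecay_of_isPreconnected hinv
        (S := Set.Ioo 0 a) isPreconnected_Ioo (fun ν hν => hν.1)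
        (fun ν hν => hres ν hν.1 fun h' => hν.2.not_ge h'.1)
        (μ₀ := μ₀) ⟨h0, h1.trans_le (min_le_left _ _)⟩
        (expDecay_greenKernel_zero (hu μ₀ h0) fun n => ?_) ⟨hμ, hlt⟩⟩
      rw [inv_smul_matrix (inv_ne_zero h0.ne') (hinv n), inv_inv, norm_smul_matrix, abs_of_pos h0]
      have h2 : μ₀ * (2 * (|L| + 1)) < 1 := by
        rw [← lt_inv_mul_iff₀' hM', mul_one]
        exact h1.trans_le (min_le_right _ _)
      have h3 : ‖(C n)⁻¹‖ ≤ |L| + 1 := by linarith [hL n, le_abs_self L]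
      nlinarith [mul_le_mul_of_nonneg_left h3 h0.le]
    · have hb : b < μ := not_le.1 fun hle => h ⟨hge, hle⟩
      have hb0 : 0 < b := ha.trans_le hab
      -- At this parameter the scaled matrices have norm at most `1 / 2`, so the projection on `(b,
      -- ∞)` is `1`.
      have hm : b < max (b + 1) (2 * (|M| + 1)) := lt_max_of_lt_left (by linarith)
      have hm0 := hb0.trans hm
      refine ⟨1, Matrix.blockTriangular_one, expDecay_of_isPreconnected hinv
        (S := Set.Ioi b) isPreconnected_Ioi (fun ν hν => hb0.trans hν)
        (fun ν hν => hres ν (hb0.trans hν) fun h' => (Set.mem_Ioi.1 hν).not_ge h'.2)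
        (μ₀ := max (b + 1) (2 * (|M| + 1))) hm
        (expDecay_greenKernel_one (hu _ hm0) fun n => ?_) hb⟩
      rw [norm_smul_matrix, abs_of_pos (inv_pos.2 hm0), inv_mul_le_iff₀ hm0]
      have h3 : ‖C n‖ ≤ |M| + 1 := by linarith [hM n, le_abs_self M]
      linarith [le_max_right (b + 1) (2 * (|M| + 1))]
  ext μ
  rw [Set.mem_iUnion]
  constructor
  · rintro ⟨hμ, hnot⟩
    by_contra! hcon
    refine hnot (hasExpDichotomy_of_diag (hu μ hμ) (hT μ) (M := |μ⁻¹| * M)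
      (fun n => ?_) fun i => ?_)
    · rw [norm_smul_matrix]
      exact mul_le_mul_of_nonneg_left (hM n) (abs_nonneg _)
    · by_contra hi
      exact hcon i ⟨hμ, by rwa [hscalar]⟩
  · rintro ⟨i, hμ, hnot⟩
    rw [hspec]
    by_contra hcon
    obtain ⟨P, hP, hdec⟩ := hproj μ hμ hcon
    rw [hscalar] at hnot
    exact hnot (hasExpDichotomy_diag (hu μ hμ) (hT μ) hP hdec i)
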